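/- An ordinal $\alpha>0$ is an accumulation point of a set of ordinals $A$ if $\alpha=\sup(A\cap\alpha)$; let $\mathrm{acc}(A)$ be the set of accumulation points of $A$ and $\mathrm{nacc}(A)=A\setminus\mathrm{acc}(A)$. For a set $S$ of limit ordinals, a strict club system on $S$ is a sequence $\bar C=\langle C_\delta:\delta\in S\rangle$ such that each $C_\delta$ is a club (closed unbounded subset) of $\delta$ of order type $\mathrm{cf}(\delta)$. For $S\subseteq\aleph_2$, let $\mathrm{id}_p(\bar C)$ be the family of all $A\subseteq\aleph_2$ such that for some club $E$ of $\aleph_2$ there is no $\delta\in S\cap\mathrm{acc}(E)$ with $\delta=\sup(A\cap E\cap\mathrm{nacc}(C_\delta))$. Claim. Let $S\subseteq\{\delta<\aleph_2:\mathrm{cf}(\delta)=\aleph_1\text{ and }\delta\text{ is divisible by }(\omega_1)^2\}$ be a stationary subset of $\aleph_2$. Then there are a strict club system $\bar C=\langle C_\delta:\delta\in S\rangle$ on $S$ and functions $h_\delta:C_\delta\to\omega$ $(\delta\in S)$ such that: (1) $\aleph_2\notin\mathrm{id}_p(\bar C)$; (2) for all $\delta\in S$ and $\alpha\in\mathrm{nacc}(C_\delta)$,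 $\mathrm{cf}(\alpha)=\aleph_1$; (3) for every club $E$ of $\aleph_2$ there is $\delta\in S$ such that for every $n<\omega$, $\delta=\sup\bigl(h_\delta^{-1}(\{n\})\cap E\cap\mathrm{nacc}(C_\delta)\bigr)$. -/

import Mathlib

universe u

open Cardinal Ordinal Set

namespace ClubGuessing

/-- `C` is a club (closed unbounded subset) of the ordinal `δ`. -/
def IsClubIn (C : Set Ordinal.{u}) (δ : Ordinal.{u}) : Prop :=
  C ⊆ Iio δ ∧ IsClub (Subtype.val ⁻¹' C : Set (Iio δ))

/-- `S` is a stationary subset of the ordinal `δ`: it meets every club of `δ`. -/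
def IsStationaryIn (S : Set Ordinal.{u}) (δ : Ordinal.{u}) : Prop :=
  S ⊆ Iio δ ∧ ∀ E, IsClubIn E δ → (S ∩ E).Nonempty

/-- `A` is unbounded in `δ`; for a limit ordinal `δ` this says `δ = sup (A ∩ δ)`. -/
def IsUnboundedIn (A : Set Ordinal.{u}) (δ : Ordinal.{u}) : Prop :=
  ∀ β < δ, ∃ α ∈ A, β < α ∧ α < δ

/-- The accumulation points of a set of ordinals: the `α > 0` with `α = sup (A ∩ α)`. -/
def acc (A : Set Ordinal.{u}) : Set Ordinal.{u} :=
  {α | α ≠ 0 ∧ IsUnboundedIn A α}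

/-- The non-accumulation points of `A`: the members of `A` which are not in `acc A`. -/
def nacc (A : Set Ordinal.{u}) : Set Ordinal.{u} :=
  A \ acc A

/-- `⟨C δ : δ ∈ S⟩` is a strict club system on `S`: for `δ ∈ S`, `C δ` is a club of `δ` of
order type `cf δ`. -/
def IsStrictClubSystem (S : Set Ordinal.{u}) (C : Ordinal.{u} → Set Ordinal.{u}) : Prop :=
  ∀ δ ∈ S, IsClubIn (C δ) δ ∧
    Ordinal.type (α := C δ) (· < ·) = Ordinal.lift.{u + 1} δ.cof.ord

/-- The ideal `id_p(C̄, Ī)` on `κ`, where `C̄ = ⟨C δ : δ ∈ S⟩` and `I δ` is an ideal on `C δ`: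
the sets `A ⊆ κ` such that for some club `E` of `κ`, for no `δ ∈ S ∩ acc E` does
`A ∩ E ∩ C δ ∉ I δ` hold. -/
def idPI (κ : Ordinal.{u}) (S : Set Ordinal.{u}) (C : Ordinal.{u} → Set Ordinal.{u})
    (I : Ordinal.{u} → Set (Set Ordinal.{u})) : Set (Set Ordinal.{u}) :=
  {A | A ⊆ Iio κ ∧ ∃ E, IsClubIn E κ ∧ ∀ δ ∈ S ∩ acc E, A ∩ E ∩ C δ ∈ I δ}

/-- The ideal on `C δ` generated by the bounded subsets and `acc (C δ)`: the subsets of `C δ`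
whose intersection with `nacc (C δ)` is bounded in `δ`. -/
def naccBounded (C : Ordinal.{u} → Set Ordinal.{u}) (δ : Ordinal.{u}) : Set (Set Ordinal.{u}) :=
  {A | A ⊆ C δ ∧ ¬ IsUnboundedIn (A ∩ nacc (C δ)) δ}

/-- The ideal `id_p(C̄)` on `κ`. -/
def idP (κ : Ordinal.{u}) (S : Set Ordinal.{u}) (C : Ordinal.{u} → Set Ordinal.{u}) :
    Set (Set Ordinal.{u}) :=
  idPI κ S C (naccBounded C)

end ClubGuessing

namespace ClubGuessing

/-! Everything reduces to thin sets (`IsThinIn`): the closure of a thin `Y` below `δ` is a club of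
type `ω₁`, and its non-accumulation points are exactly `Y`, since a point of cofinality `ℵ₁` is no
limit of countably many points. Divisibility by `ω₁²` supplies thin sets at each `δ ∈ S`.

Guessing (`exists_thin_guessing`): if every system fails, let each `E n` defeat the systems built
from the earlier clubs. For fixed `β`, the last point of `E n` up to `β` decreases with `n`, so it
stabilizes. Where the stable value has countable cofinality, step down along a countable cofinal
set. Well-foundedness ends this at a point of cofinality `ℵ₁`, which is in the glued set for `E N`
and in the club meant to avoid it.

Colouring (`exists_coloring`): code each countable `Y ∩ y` by naturals. Some code `n` is taken at
infinitely many `ξ` below some `σ < δ`, each for cofinally many guessed `y`. Colour `y` by the rank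
of the `ξ` coded `n` below it. The ranking depends on a club, but along an `ω₁`-sequence of clubs it
stabilizes on the countable set `Y ∩ σ`, and then every colour occurs cofinally. -/

/-! ### Bounded and unbounded sets, clubs -/

theorem exists_lt_of_mk_lt_cof {s : Set Ordinal.{u}} {δ : Ordinal.{u}}
    (hs : #s < Cardinal.lift.{u + 1} δ.cof) (h : ∀ x ∈ s, x < δ) : ∃ γ < δ, ∀ x ∈ s, x < γ := by
  refine ⟨_, sSup_add_one_lt_of_lt_cof (by rwa [← lift_cof]) h, fun x hx ↦ ?_⟩
  rw [← Order.add_one_le_iff]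
  refine le_csSup ⟨δ + 1, ?_⟩ (mem_image_of_mem _ hx)
  rintro _ ⟨y, hy, rfl⟩
  exact add_le_add_left (h y hy).le 1

theorem exists_lt_of_countable {s : Set Ordinal.{u}} {δ : Ordinal.{u}} (hδ : ℵ₀ < δ.cof)
    (hs : s.Countable) (h : ∀ x ∈ s, x < δ) : ∃ γ < δ, ∀ x ∈ s, x < γ := by
  refine exists_lt_of_mk_lt_cof (lt_of_le_of_lt (le_aleph0_iff_set_countable.2 hs) ?_) h
  exact aleph0_lt_lift.2 hδ

theorem exists_lt_of_countable_index {ι : Type*} [Countable ι] {f : ι → Ordinal.{u}}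
    {δ : Ordinal.{u}} (hδ : ℵ₀ < δ.cof) (h : ∀ i, f i < δ) : ∃ γ < δ, ∀ i, f i < γ := by
  obtain ⟨γ, hγ, h'⟩ := exists_lt_of_countable hδ (countable_range f) (by simpa using h)
  exact ⟨γ, hγ, by simpa using h'⟩

theorem not_isUnboundedIn {A : Set Ordinal.{u}} {δ : Ordinal.{u}} :
    ¬ IsUnboundedIn A δ ↔ ∃ β < δ, ∀ α ∈ A, α < δ → α ≤ β := by
  unfold IsUnboundedIn
  push Not
  refine exists_congr fun β ↦ and_congr_right fun _ ↦ forall₂_congr fun α _ ↦ ?_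
  constructor
  · intro h h1
    by_contra! h2
    exact h1.not_ge (h h2)
  · intro h h1
    by_contra! h2
    exact h1.not_ge (h h2)

theorem IsUnboundedIn.mono {A B : Set Ordinal.{u}} {δ : Ordinal.{u}} (h : IsUnboundedIn A δ)
    (hAB : A ∩ Iio δ ⊆ B) : IsUnboundedIn B δ := fun β hβ ↦ by
  obtain ⟨α, h1, h2, h3⟩ := h β hβ
  exact ⟨α, hAB ⟨h1, h3⟩, h2, h3⟩

/-- An unbounded subset of an ordinal of uncountable cofinality is uncountable. -/
theorem IsUnboundedIn.not_countable {A : Set Ordinal.{u}} {δ : Ordinal.{u}}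
    (h : IsUnboundedIn A δ) (hδ : ℵ₀ < δ.cof) : ¬ (A ∩ Iio δ).Countable := fun hc ↦ by
  obtain ⟨γ, hγ, h'⟩ := exists_lt_of_countable hδ hc fun x hx ↦ hx.2
  obtain ⟨α, h1, h2, h3⟩ := h γ hγ
  exact (h' α ⟨h1, h3⟩).not_gt h2

theorem isUnboundedIn_acc {A : Set Ordinal.{u}} {δ : Ordinal.{u}}
    (h : IsUnboundedIn (A ∪ acc A) δ) : IsUnboundedIn A δ := fun β hβ ↦ by
  obtain ⟨α, h1 | h1, h2, h3⟩ := h β hβ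
  · exact ⟨α, h1, h2, h3⟩
  · obtain ⟨x, h4, h5, h6⟩ := h1.2 β h2
    exact ⟨x, h4, h5, h6.trans h3⟩

theorem isClubIn_of_acc {C : Set Ordinal.{u}} {δ : Ordinal.{u}} (hC : C ⊆ Iio δ)
    (hu : IsUnboundedIn C δ) (hc : acc C ∩ Iio δ ⊆ C) : IsClubIn C δ := by
  refine ⟨hC, fun d hd hne _ a ha ↦ ?_, fun β ↦ ?_⟩
  · by_contra hac
    have key : ∀ x ∈ d, x < a := fun x hx ↦
      lt_of_le_of_ne (ha.1 hx) (by rintro rfl; exact hac (hd hx))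
    refine hac (hc ⟨⟨?_, fun β hβ ↦ ?_⟩, a.2⟩)
    · obtain ⟨x, hx⟩ := hne
      exact (bot_le.trans_lt (show x.1 < a.1 from key x hx)).ne'
    · obtain ⟨x, hx, hx'⟩ := (lt_isLUB_iff ha).1 (show (⟨β, hβ.trans a.2⟩ : Iio δ) < a from hβ)
      exact ⟨x, hd hx, hx', key x hx⟩
  · obtain ⟨α, h1, h2, h3⟩ := hu β β.2
    exact ⟨⟨α, h3⟩, h1, h2.le⟩

theorem IsClubIn.mem_of_acc {C : Set Ordinal.{u}} {δ ν : Ordinal.{u}} (h : IsClubIn C δ)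
    (hν : ν ∈ acc C) (hνδ : ν < δ) : ν ∈ C := by
  refine h.2.isLUB_mem (t := {x : Iio δ | x.1 ∈ C ∧ x.1 < ν}) (x := ⟨ν, hνδ⟩)
    (fun x hx ↦ hx.1) ?_ ⟨fun x hx ↦ hx.2.le, fun b hb ↦ ?_⟩
  · obtain ⟨α, h1, -, h3⟩ := hν.2 0 (pos_iff_ne_zero.2 hν.1)
    exact ⟨⟨α, h3.trans hνδ⟩, h1, h3⟩
  · by_contra! hbν
    obtain ⟨α, h1, h2, h3⟩ := hν.2 b hbν
    exact (show α ≤ b.1 from hb (a := ⟨α, h3.trans hνδ⟩) ⟨h1, h3⟩).not_gt h2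

theorem IsClubIn.isUnboundedIn {C : Set Ordinal.{u}} {δ : Ordinal.{u}} (h : IsClubIn C δ)
    (hδ : ℵ₀ < δ.cof) : IsUnboundedIn C δ := fun β hβ ↦ by
  have hl : Order.IsSuccLimit δ := one_lt_cof_iff.1 (one_lt_aleph0.trans hδ)
  obtain ⟨α, h1, h2⟩ := h.2.isCofinal ⟨_, hl.succ_lt hβ⟩
  exact ⟨α, h1, (Order.lt_succ β).trans_le h2, α.2⟩

/-! ### Last points of a club -/

/-- The last element of `E` which is at most `β`. -/
noncomputable def drop (E : Set Ordinal.{u}) (β : Ordinal.{u}) : Ordinal.{u} :=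
  sSup (E ∩ Iic β)

theorem drop_le (E : Set Ordinal.{u}) (β : Ordinal.{u}) : drop E β ≤ β :=
  csSup_le' fun _ hx ↦ hx.2

theorem le_drop {E : Set Ordinal.{u}} {x β : Ordinal.{u}} (hx : x ∈ E) (h : x ≤ β) :
    x ≤ drop E β :=
  le_csSup ⟨β, fun _ hx ↦ hx.2⟩ ⟨hx, h⟩

theorem drop_mono {E F : Set Ordinal.{u}} (h : E ⊆ F) (β : Ordinal.{u}) : drop E β ≤ drop F β :=
  csSup_le' fun _ hx ↦ le_drop (h hx.1) hx.2

/-- The witness `x` excludes the empty supremum, whose default value `0` need not lie in `E`. -/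
theorem IsClubIn.drop_mem {E : Set Ordinal.{u}} {δ x β : Ordinal.{u}} (hE : IsClubIn E δ)
    (hx : x ∈ E) (h : x ≤ β) (hβ : β < δ) : drop E β ∈ E := by
  by_contra hd
  have hlt : ∀ y ∈ E, y ≤ β → y < drop E β := fun y hy hyβ ↦
    lt_of_le_of_ne (le_drop hy hyβ) (by rintro rfl; exact hd hy)
  refine hd (hE.mem_of_acc ⟨(bot_le.trans_lt (hlt x hx h)).ne', fun γ hγ ↦ ?_⟩
    ((drop_le E β).trans_lt hβ))
  obtain ⟨y, hy, hγy⟩ := exists_lt_of_lt_csSup (s := E ∩ Iic β) ⟨x, hx, h⟩ hγ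
  exact ⟨y, hy.1, hγy, hlt y hy.1 hy.2⟩

/-! ### Cofinalities and clubs below `ω₂` -/

theorem aleph0_lt_cof_of_eq {δ : Ordinal.{u}} (h : δ.cof = ℵ_ 1) : ℵ₀ < δ.cof :=
  h ▸ aleph0_lt_aleph_one

theorem cof_omega_two : (ω_ 2 : Ordinal.{u}).cof = ℵ_ 2 := by
  have h := isRegular_aleph_add_one.{u} 1
  rw [one_add_one_eq_two] at h
  exact h.cof_omega_eq

theorem aleph0_lt_cof_omega_two : ℵ₀ < (ω_ 2 : Ordinal.{u}).cof := by
  rw [cof_omega_two, ← aleph_zero]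
  exact aleph_lt_aleph.2 two_pos

theorem aleph_one_lt_cof_omega_two : ℵ_ 1 < (ω_ 2 : Ordinal.{u}).cof := by
  rw [cof_omega_two]
  exact aleph_lt_aleph.2 one_lt_two

theorem card_le_aleph_one {x : Ordinal.{u}} (h : x < ω_ 2) : x.card ≤ ℵ_ 1 := by
  have h1 : x.card < ℵ_ 2 := by
    rwa [← ord_aleph, lt_ord] at h
  rw [← one_add_one_eq_two, ← succ_aleph] at h1
  exact Order.le_of_lt_succ h1

theorem cof_le_aleph_one {x : Ordinal.{u}} (h : x < ω_ 2) : x.cof ≤ ℵ_ 1 :=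
  (cof_le_card x).trans (card_le_aleph_one h)

theorem cof_eq_aleph_one {x : Ordinal.{u}} (h : x < ω_ 2) (h' : ℵ₀ < x.cof) : x.cof = ℵ_ 1 := by
  refine (cof_le_aleph_one h).antisymm ?_
  rw [← succ_aleph0]
  exact Order.succ_le_of_lt h'

theorem isClubIn_acc {A : Set Ordinal.{u}} {δ : Ordinal.{u}} (hδ : ℵ₀ < δ.cof)
    (hA : IsUnboundedIn A δ) : IsClubIn (acc A ∩ Iio δ) δ := by
  refine isClubIn_of_acc inter_subset_right (fun β hβ ↦ ?_) fun ν hν ↦ ⟨⟨hν.1.1, ?_⟩, hν.2⟩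
  -- Iterating a choice of larger members of `A` gives an `ω`-sequence; its supremum stays below `δ`
  -- by uncountable cofinality.
  · choose! g hg using hA
    have hlt : ∀ n : ℕ, g^[n + 1] β < δ ∧ g^[n + 1] β ∈ A ∧ g^[n] β < g^[n + 1] β := by
      intro n
      induction n with
      | zero => exact ⟨(hg β hβ).2.2, (hg β hβ).1, (hg β hβ).2.1⟩
      | succ n ih =>
        rw [Function.iterate_succ_apply' _ (n + 1)]
        exact ⟨(hg _ ih.1).2.2, (hg _ ih.1).1, (hg _ ih.1).2.1⟩
    let ν := ⨆ n : ℕ, g^[n + 1] β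
    have hle : ∀ n, g^[n + 1] β ≤ ν := fun n ↦ Ordinal.le_iSup (fun n : ℕ ↦ g^[n + 1] β) n
    obtain ⟨γ, hγ, hγ'⟩ := exists_lt_of_countable_index (f := fun n : ℕ ↦ g^[n + 1] β) hδ
      fun n ↦ (hlt n).1
    have hνδ : ν < δ := (Ordinal.iSup_le fun n ↦ (hγ' n).le).trans_lt hγ
    have hβν : β < ν := (hlt 0).2.2.trans_le (hle 0)
    refine ⟨ν, ⟨⟨(bot_le.trans_lt hβν).ne', fun x hx ↦ ?_⟩, hνδ⟩, hβν, hνδ⟩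
    obtain ⟨n, hn⟩ := (Ordinal.lt_iSup_iff).1 hx
    exact ⟨_, (hlt n).2.1, hn, (hlt (n + 1)).2.2.trans_le (hle _)⟩
  · exact isUnboundedIn_acc (hν.1.2.mono fun x hx ↦ Or.inr hx.1.1)

theorem IsClubIn.inter {C D : Set Ordinal.{u}} {δ : Ordinal.{u}} (hδ : ℵ₀ < δ.cof)
    (hC : IsClubIn C δ) (hD : IsClubIn D δ) : IsClubIn (C ∩ D) δ := by
  refine ⟨inter_subset_left.trans hC.1, ?_⟩
  rw [preimage_inter]
  refine IsClub.inter ?_ hC.2 hD.2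
  rw [Ordinal.cof_Iio, ← lift_cof]
  exact (aleph0_lt_lift.2 hδ).ne'

theorem IsClubIn.iInter {ι : Type u} {C : ι → Set Ordinal.{u}} {δ : Ordinal.{u}} (hδ : ℵ₀ < δ.cof)
    (hι : #ι < δ.cof) (hC : ∀ i, IsClubIn (C i) δ) : IsClubIn (Iio δ ∩ ⋂ i, C i) δ := by
  refine ⟨inter_subset_left, ?_⟩
  have : (Subtype.val ⁻¹' (Iio δ ∩ ⋂ i, C i) : Set (Iio δ)) = ⋂ i, Subtype.val ⁻¹' C i := by
    ext x
    simp
  rw [this]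
  refine IsClub.iInter ?_ ?_ fun i ↦ (hC i).2
  · rw [Ordinal.cof_Iio, ← lift_cof]
    exact (aleph0_lt_lift.2 hδ).ne'
  · rw [Ordinal.cof_Iio, ← lift_cof]
    rw [Cardinal.lift_id'.{u, u + 1}]
    exact Cardinal.lift_lt.2 hι

/-! ### Iterated refinement of clubs -/

/-- A transfinite sequence of sets in which each set refines `F` of all the earlier ones. -/
noncomputable def refineSeq (F : Set Ordinal.{u} → Set Ordinal.{u}) (δ i : Ordinal.{u}) :
    Set Ordinal.{u} :=
  Iio δ ∩ ⋂ j : i.ToType,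
    F (refineSeq F δ j.toOrd) ∩ refineSeq F δ j.toOrd
termination_by i
decreasing_by all_goals exact j.toOrd.2

theorem refineSeq_subset (F : Set Ordinal.{u} → Set Ordinal.{u}) (δ : Ordinal.{u})
    {i j : Ordinal.{u}} (h : i < j) :
    refineSeq F δ j ⊆ F (refineSeq F δ i) ∩ refineSeq F δ i := by
  intro x hx
  rw [refineSeq] at hx
  have := mem_iInter.1 hx.2 (ToType.mk ⟨i, h⟩)
  simpa using this

theorem isClubIn_refineSeq {F : Set Ordinal.{u} → Set Ordinal.{u}} {δ : Ordinal.{u}}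
    (hδ : ℵ₀ < δ.cof) (hF : ∀ E, IsClubIn E δ → IsClubIn (F E) δ) (i : Ordinal.{u})
    (hi : i.card < δ.cof) : IsClubIn (refineSeq F δ i) δ := by
  induction i using WellFoundedLT.induction with
  | ind i ih =>
    rw [refineSeq]
    refine IsClubIn.iInter hδ (by simpa using hi) fun j ↦ ?_
    have hj : (j.toOrd : Ordinal) < i := j.toOrd.2
    have := ih _ hj ((card_le_card hj.le).trans_lt hi)
    exact (hF _ this).inter hδ this

/-! ### Order type `ω₁` and points of cofinality `ℵ₁` -/

theorem type_le_omega_one {A : Set Ordinal.{u}} (hA : ∀ a ∈ A, (A ∩ Iio a).Countable) :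
    Ordinal.type (α := A) (· < ·) ≤ ω_ 1 := by
  refine le_of_forall_lt fun o ho ↦ ?_
  obtain ⟨a, rfl⟩ := typein_surj _ ho
  have h : (typein (α := A) (· < ·) a).card ≤ ℵ₀ := by
    rw [card_typein]
    refine le_aleph0_iff_set_countable (s := {y : A | y < a}).2 ?_
    refine MapsTo.countable_of_injOn (f := Subtype.val) (t := A ∩ Iio a.1) ?_
      Subtype.val_injective.injOn (hA a a.2)
    exact fun x hx ↦ ⟨x.2, hx⟩
  rw [← ord_aleph, lt_ord]
  exact h.trans_lt aleph0_lt_aleph_one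

theorem type_eq_lift_ord_cof {A : Set Ordinal.{u}} {δ : Ordinal.{u}} (hδ : δ.cof = ℵ_ 1)
    (hAδ : A ⊆ Iio δ) (hu : IsUnboundedIn A δ) (hA : ∀ ν < δ, (A ∩ Iio ν).Countable) :
    Ordinal.type (α := A) (· < ·) = Ordinal.lift.{u + 1} δ.cof.ord := by
  rw [hδ, ord_aleph, lift_omega, Ordinal.lift_one]
  refine (type_le_omega_one fun a ha ↦ hA a (hAδ ha)).antisymm ?_
  by_contra! h
  rw [← ord_aleph, lt_ord, card_type, ← succ_aleph0, Order.lt_succ_iff,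
    le_aleph0_iff_set_countable] at h
  exact hu.not_countable (aleph0_lt_cof_of_eq hδ) (h.mono inter_subset_left)

theorem le_toOrd {δ β : Ordinal.{u}} (hβ : β < δ) {a : δ.ToType} (h : ToType.mk ⟨β, hβ⟩ ≤ a) :
    β ≤ (a.toOrd : Ordinal) := by
  have := ToType.mk.symm.monotone h
  rw [OrderIso.symm_apply_apply] at this
  exact this

theorem exists_countable_cofinal {δ : Ordinal.{u}} (hδ : δ.cof ≤ ℵ₀) :
    ∃ s : Set Ordinal.{u}, s.Countable ∧ (∀ x ∈ s, x < δ) ∧ ∀ β < δ, ∃ x ∈ s, β ≤ x := by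
  rw [← cof_toType] at hδ
  obtain ⟨s, hs, hs'⟩ := Order.exists_cof_eq δ.ToType
  rw [← hs', le_aleph0_iff_set_countable] at hδ
  refine ⟨(fun a : δ.ToType ↦ (a.toOrd : Ordinal)) '' s, hδ.image _, ?_, fun β hβ ↦ ?_⟩
  · rintro _ ⟨a, -, rfl⟩
    exact a.toOrd.2
  · obtain ⟨a, ha, hβa⟩ := hs (ToType.mk ⟨β, hβ⟩)
    refine ⟨_, mem_image_of_mem _ ha, ?_⟩
    exact le_toOrd hβ hβa

/-- A club of `ω₂` has a member of cofinality `ℵ₁`. -/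
theorem IsClubIn.exists_cof_eq {E : Set Ordinal.{u}} (hE : IsClubIn E (ω_ 2)) :
    ∃ ν ∈ E, ν.cof = ℵ_ 1 := by
  have hu := hE.isUnboundedIn aleph0_lt_cof_omega_two
  have hex : ∃ ν, ν ∈ E ∧ ¬ (E ∩ Iio ν).Countable := by
    by_contra! h
    have hc := card_le_card (type_le_omega_one h)
    rw [card_type, card_omega] at hc
    obtain ⟨γ, hγ, h'⟩ := exists_lt_of_mk_lt_cof (s := E) (δ := ω_ 2) (hc.trans_lt (by
      rw [cof_omega_two, lift_aleph, aleph_lt_aleph, Ordinal.lift_ofNat]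
      exact one_lt_two)) hE.1
    obtain ⟨α, h1, h2, -⟩ := hu γ hγ
    exact (h' α h1).not_gt h2
  -- At the least `ν ∈ E` with uncountably many predecessors in `E`, countable cofinality would make
  -- these a countable union of countable sets.
  obtain ⟨ν, ⟨hν, hnc⟩, hmin⟩ := WellFounded.has_min (wellFounded_lt (α := Ordinal.{u}))
    {ν | ν ∈ E ∧ ¬ (E ∩ Iio ν).Countable} hex
  refine ⟨ν, hν, cof_eq_aleph_one (hE.1 hν) ?_⟩
  by_contra! hcof
  obtain ⟨s, hs, hsν, hs'⟩ := exists_countable_cofinal hcof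
  refine hnc ((hs.biUnion (t := fun a _ ↦ E ∩ Iic a) fun a ha ↦ ?_).mono fun x hx ↦ ?_)
  · rcases (E ∩ Iic a).eq_empty_or_nonempty with h | ⟨x, hxE, hxa⟩
    · simp [h]
    have hd := hE.drop_mem hxE hxa ((hsν a ha).trans (hE.1 hν))
    have hc : (E ∩ Iio (drop E a)).Countable := by
      by_contra h
      exact hmin _ ⟨hd, h⟩ ((drop_le E a).trans_lt (hsν a ha))
    refine (hc.insert (drop E a)).mono fun y hy ↦ ?_
    exact (le_drop hy.1 hy.2).eq_or_lt.imp id fun h ↦ ⟨hy.1, h⟩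
  · obtain ⟨a, ha, hxa⟩ := hs' x hx.2
    exact mem_biUnion ha ⟨hx.1, hxa⟩

theorem IsClubIn.isUnboundedIn_cof_eq {E : Set Ordinal.{u}} (hE : IsClubIn E (ω_ 2)) :
    IsUnboundedIn (E ∩ {x | x.cof = ℵ_ 1}) (ω_ 2) := fun β hβ ↦ by
  have hc : IsClubIn (E ∩ Ioi β) (ω_ 2) := by
    refine isClubIn_of_acc (inter_subset_left.trans hE.1) (fun γ hγ ↦ ?_) fun ν hν ↦ ?_
    · obtain ⟨α, h1, h2, h3⟩ :=
        hE.isUnboundedIn aleph0_lt_cof_omega_two _ (max_lt hβ hγ)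
      exact ⟨α, ⟨h1, (le_max_left _ _).trans_lt h2⟩, (le_max_right _ _).trans_lt h2, h3⟩
    · refine ⟨hE.mem_of_acc ⟨hν.1.1, hν.1.2.mono fun x hx ↦ hx.1.1⟩ hν.2, ?_⟩
      obtain ⟨α, h1, h2, h3⟩ := hν.1.2 0 (pos_iff_ne_zero.2 hν.1.1)
      exact h1.2.trans h3
  obtain ⟨ν, hν, hν'⟩ := hc.exists_cof_eq
  exact ⟨ν, ⟨hν.1, hν'⟩, hν.2, hE.1 hν.1⟩

/-- A stationary set has a member in which the points of cofinality `ℵ₁` of a given club are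
cofinal. -/
theorem exists_mem_isUnboundedIn_cof_eq {S E : Set Ordinal.{u}} (hS : IsStationaryIn S (ω_ 2))
    (hE : IsClubIn E (ω_ 2)) : ∃ δ ∈ S, IsUnboundedIn (E ∩ {x | x.cof = ℵ_ 1}) δ := by
  obtain ⟨δ, h1, h2⟩ := hS.2 _ (isClubIn_acc aleph0_lt_cof_omega_two hE.isUnboundedIn_cof_eq)
  exact ⟨δ, h1, h2.1.2⟩

/-! ### Thin sets and their closures -/

/-- `Y` is a cofinal subset of `δ` with countable bounded parts, all of whose members have
cofinality `ℵ₁`. -/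
structure IsThinIn (Y : Set Ordinal.{u}) (δ : Ordinal.{u}) : Prop where
  lt : ∀ x ∈ Y, x < δ
  cof_eq : ∀ x ∈ Y, x.cof = ℵ_ 1
  isUnboundedIn : IsUnboundedIn Y δ
  countable : ∀ ν < δ, (Y ∩ Iio ν).Countable

theorem IsThinIn.notMem_acc {Y : Set Ordinal.{u}} {δ y : Ordinal.{u}} (hY : IsThinIn Y δ)
    (hy : y ∈ Y) : y ∉ acc Y := fun h ↦
  h.2.not_countable (aleph0_lt_cof_of_eq (hY.cof_eq y hy)) (hY.countable y (hY.lt y hy))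

theorem acc_union_acc_inter_subset (Y : Set Ordinal.{u}) (δ : Ordinal.{u}) :
    acc ((Y ∪ acc Y) ∩ Iio δ) ⊆ acc Y := fun _ hν ↦
  ⟨hν.1, isUnboundedIn_acc (hν.2.mono fun _ hx ↦ hx.1.1)⟩

theorem IsThinIn.nacc_eq {Y : Set Ordinal.{u}} {δ : Ordinal.{u}} (hY : IsThinIn Y δ) :
    nacc ((Y ∪ acc Y) ∩ Iio δ) = Y := by
  ext x
  refine ⟨fun hx ↦ hx.1.1.resolve_right fun h ↦ hx.2 ⟨h.1, h.2.mono fun y hy ↦ ?_⟩, fun hx ↦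
    ⟨⟨Or.inl hx, hY.lt x hx⟩, fun h ↦ hY.notMem_acc hx (acc_union_acc_inter_subset Y δ h)⟩⟩
  exact ⟨Or.inl hy.1, hY.lt y hy.1⟩

theorem IsThinIn.isClubIn {Y : Set Ordinal.{u}} {δ : Ordinal.{u}} (hY : IsThinIn Y δ) :
    IsClubIn ((Y ∪ acc Y) ∩ Iio δ) δ :=
  isClubIn_of_acc inter_subset_right
    (hY.isUnboundedIn.mono fun _ hx ↦ ⟨Or.inl hx.1, hx.2⟩)
    fun _ hx ↦ ⟨Or.inr (acc_union_acc_inter_subset Y δ hx.1), hx.2⟩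

/-- Sending an accumulation point to the least member of `Y` at or above it is strictly increasing,
as `Y` has a member strictly between any two accumulation points. -/
theorem countable_acc_inter {Y : Set Ordinal.{u}} {ν μ : Ordinal.{u}} (hμ : μ ∈ Y) (hνμ : ν ≤ μ)
    (hY : (Y ∩ Iic μ).Countable) : (acc Y ∩ Iio ν).Countable := by
  have hne : ∀ x ∈ acc Y ∩ Iio ν, (Y ∩ Ici x).Nonempty := fun x hx ↦
    ⟨μ, hμ, (mem_Iio.1 hx.2).le.trans hνμ⟩
  refine MapsTo.countable_of_injOn (f := fun x ↦ sInf (Y ∩ Ici x)) (t := Y ∩ Iic μ)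
    (fun x hx ↦ ⟨(csInf_mem (hne x hx)).1, csInf_le' (s := Y ∩ Ici x) ⟨hμ, (mem_Iio.1 hx.2).le.trans hνμ⟩⟩) ?_ hY
  have key : ∀ x ∈ acc Y ∩ Iio ν, ∀ x' ∈ acc Y ∩ Iio ν, x < x' →
      sInf (Y ∩ Ici x) < sInf (Y ∩ Ici x') := fun x hx x' hx' hlt ↦ by
    obtain ⟨y, h1, h2, h3⟩ := hx'.1.2 x hlt
    exact (csInf_le' (show y ∈ Y ∩ Ici x from ⟨h1, h2.le⟩)).trans_lt (h3.trans_le (csInf_mem (hne x' hx')).2)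
  intro x hx x' hx' h
  by_contra hne
  rcases lt_or_gt_of_ne hne with hlt | hlt
  · exact (key x hx x' hx' hlt).ne h
  · exact (key x' hx' x hx hlt).ne h.symm

theorem IsThinIn.type_eq {Y : Set Ordinal.{u}} {δ : Ordinal.{u}} (hY : IsThinIn Y δ)
    (hδ : δ.cof = ℵ_ 1) : Ordinal.type (α := ↥((Y ∪ acc Y) ∩ Iio δ)) (· < ·) =
      Ordinal.lift.{u + 1} δ.cof.ord := by
  refine type_eq_lift_ord_cof hδ inter_subset_right
    (hY.isClubIn.isUnboundedIn (aleph0_lt_cof_of_eq hδ)) fun ν hν ↦ ?_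
  obtain ⟨μ, h1, h2, h3⟩ := hY.isUnboundedIn ν hν
  obtain ⟨μ', h4, h5, h6⟩ := hY.isUnboundedIn μ h3
  have hc : (Y ∩ Iic μ).Countable :=
    (hY.countable μ' h6).mono (inter_subset_inter_right _ (Iic_subset_Iio.2 h5))
  refine ((hY.countable ν hν).union (countable_acc_inter h1 h2.le hc)).mono fun x hx ↦ ?_
  exact hx.1.1.imp (fun h ↦ ⟨h, hx.2⟩) fun h ↦ ⟨h, hx.2⟩

/-- If the ordinals of cofinality `ℵ₁` are cofinal in `δ` and `δ` has cofinality `ℵ₁`, then `δ`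
has a thin subset. -/
theorem exists_isThinIn {δ : Ordinal.{u}} (hδ : δ.cof = ℵ_ 1)
    (hu : IsUnboundedIn {x | x.cof = ℵ_ 1} δ) : ∃ Y, IsThinIn Y δ := by
  obtain ⟨s, hs, hs'⟩ := exists_ord_cof_eq δ.ToType
  rw [cof_toType, hδ] at hs'
  choose! g hg using hu
  have hlt (a : δ.ToType) : (a.toOrd : Ordinal) < δ := a.toOrd.2
  refine ⟨(fun a : δ.ToType ↦ g a.toOrd) '' s, ?_, ?_, fun β hβ ↦ ?_, fun ν hν ↦ ?_⟩
  · rintro _ ⟨a, -, rfl⟩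
    exact (hg _ (hlt a)).2.2
  · rintro _ ⟨a, -, rfl⟩
    exact (hg _ (hlt a)).1
  · obtain ⟨a, ha, hβa⟩ := hs (ToType.mk ⟨β, hβ⟩)
    refine ⟨_, mem_image_of_mem _ ha, lt_of_le_of_lt ?_ (hg _ (hlt a)).2.1, (hg _ (hlt a)).2.2⟩
    exact le_toOrd hβ hβa
  · obtain ⟨b, hb, hνb⟩ := hs (ToType.mk ⟨ν, hν⟩)
    have hb' : ν ≤ (b.toOrd : Ordinal) := le_toOrd hν hνb
    have hc : {a : s | a < ⟨b, hb⟩}.Countable := by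
      rw [← le_aleph0_iff_set_countable]
      have := typein_lt_type (α := s) (· < ·) ⟨b, hb⟩
      rw [hs', lt_ord, card_typein, ← succ_aleph0, Order.lt_succ_iff] at this
      exact this
    -- `g a < ν ≤ b` forces `a < b`, and `b` has only countably many predecessors in a set of type
    -- `ω₁`.
    refine (hc.image fun a : s ↦ g a.1.toOrd).mono ?_
    rintro _ ⟨⟨a, ha, rfl⟩, haν⟩
    refine ⟨⟨a, ha⟩, ?_, rfl⟩
    have h1 : (a.toOrd : Ordinal) < b.toOrd := ((hg _ (hlt a)).2.1.trans haν).trans_le hb'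
    exact ToType.mk.symm.lt_iff_lt.1 (show a.toOrd < b.toOrd from h1)

/-- Here `δ = ω₁ · (ω₁ · γ)` with limit second factor, so the points `ω₁ · ξ + ω₁` are cofinal in
it. -/
theorem isUnboundedIn_cof_eq_of_dvd {δ : Ordinal.{u}} (h0 : δ ≠ 0) (hδ : ω_ 1 ^ (2 : ℕ) ∣ δ) :
    IsUnboundedIn {x | x.cof = ℵ_ 1} δ := by
  obtain ⟨γ, rfl⟩ := hδ
  intro β hβ
  have hγ : γ ≠ 0 := by
    rintro rfl
    simp at h0
  have hl : Order.IsSuccLimit (ω_ 1 * γ) :=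
    isSuccLimit_mul_left (isSuccLimit_omega 1) (pos_iff_ne_zero.2 hγ)
  rw [pow_two, mul_assoc] at hβ ⊢
  obtain ⟨ξ, hξ, hβξ⟩ := (lt_mul_iff_of_isSuccLimit hl).1 hβ
  have hpos : 0 < (ω_ 1 : Ordinal.{u}) := omega_pos 1
  refine ⟨ω_ 1 * ξ + ω_ 1, ?_, hβξ.trans (lt_add_of_pos_right _ hpos), ?_⟩
  · rw [mem_ofPred_eq, cof_add _ hpos.ne', isRegular_aleph_one.cof_omega_eq]
  · rw [← mul_add_one]
    exact (mul_lt_mul_iff_right₀ hpos).2 (hl.add_one_lt hξ)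

/-! ### Club guessing by descent -/

/-- The points reached from `α` in `n` steps, where a step moves from `ε` to the last element of
`E` below some member of `e ε`. -/
noncomputable def descent (e : Ordinal.{u} → Set Ordinal.{u}) (E : Set Ordinal.{u})
    (α : Ordinal.{u}) : ℕ → Set Ordinal.{u}
  | 0 => {drop E α}
  | n + 1 => ⋃ ε ∈ descent e E α n, drop E '' e ε

theorem countable_descent {e : Ordinal.{u} → Set Ordinal.{u}} (he : ∀ ε, (e ε).Countable)
    (E : Set Ordinal.{u}) (α : Ordinal.{u}) (n : ℕ) : (descent e E α n).Countable := by
  induction n with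
  | zero => exact countable_singleton _
  | succ n ih => exact ih.biUnion fun ε _ ↦ (he ε).image _

/-- The thin set at `δ` obtained by descending into `E` from the points of the thin set `Z`. -/
def glue (e : Ordinal.{u} → Set Ordinal.{u}) (Z E : Set Ordinal.{u}) (δ : Ordinal.{u}) :
    Set Ordinal.{u} :=
  {x | x < δ ∧ x.cof = ℵ_ 1 ∧ ∃ α ∈ Z, (∃ n, x ∈ descent e E α n) ∧ ∀ c ∈ Z, c < α → c ≤ x} ∪ Z

/-- A point descended from `α` is at least every member of `Z` below `α`, so only countably many `α`
contribute points below a given `ν < δ`. -/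
theorem isThinIn_glue {e : Ordinal.{u} → Set Ordinal.{u}} (he : ∀ ε, (e ε).Countable)
    {Z : Set Ordinal.{u}} (E : Set Ordinal.{u}) {δ : Ordinal.{u}} (hZ : IsThinIn Z δ) :
    IsThinIn (glue e Z E δ) δ where
  lt x hx := hx.elim (fun h ↦ h.1) (hZ.lt x)
  cof_eq x hx := hx.elim (fun h ↦ h.2.1) (hZ.cof_eq x)
  isUnboundedIn := hZ.isUnboundedIn.mono fun _ hx ↦ Or.inr hx.1
  countable ν hν := by
    obtain ⟨c, hc, hνc, hcδ⟩ := hZ.isUnboundedIn ν hν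
    obtain ⟨d, hd, hcd, hdδ⟩ := hZ.isUnboundedIn c hcδ
    refine (((hZ.countable d hdδ).biUnion (t := fun α _ ↦ ⋃ n, descent e E α n) fun α _ ↦
      countable_iUnion (countable_descent he E α)).union (hZ.countable ν hν)).mono ?_
    rintro x ⟨⟨-, -, α, hα, hx, hx'⟩ | hx, hxν⟩
    · refine Or.inl (mem_biUnion (⟨hα, ?_⟩ : α ∈ Z ∩ Iio d) (mem_iUnion.2 hx))
      by_contra hdα
      rw [mem_Iio, not_lt] at hdα
      exact (hx' c hc (hcd.trans_le hdα)).not_gt (mem_Iio.1 hxν |>.trans hνc)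
    · exact Or.inr ⟨hx, hxν⟩

/-- An antitone sequence of ordinals is eventually constant. -/
theorem exists_forall_ge_eq {f : ℕ → Ordinal.{u}} (hf : Antitone f) :
    ∃ n, ∀ m ≥ n, f m = f n := by
  obtain ⟨n, hn⟩ := WellFounded.has_min (wellFounded_lt (α := Ordinal.{u})) (range f)
    (range_nonempty f)
  obtain ⟨⟨n, rfl⟩, hn⟩ := ‹_›
  exact ⟨n, fun m hm ↦ (hf hm).eq_of_not_lt (hn _ (mem_range_self m))⟩

/-- If the clubs `E n` decrease, then from any `α` above a point `η` of cofinality `ℵ₁` lying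
in all of them, the descents into `E n` reach, for all large `n`, a common point `ε ≥ η` of
cofinality `ℵ₁`. -/
theorem exists_descent_cof_eq {e : Ordinal.{u} → Set Ordinal.{u}}
    (he : ∀ ε, ε.cof ≤ ℵ₀ → (∀ x ∈ e ε, x < ε) ∧ ∀ β < ε, ∃ x ∈ e ε, β ≤ x)
    {E : ℕ → Set Ordinal.{u}} (hE : ∀ n, IsClubIn (E n) (ω_ 2)) (hanti : Antitone E)
    {η α : Ordinal.{u}} (hη : η.cof = ℵ_ 1) (hηE : ∀ n, η ∈ E n) (hηα : η ≤ α) (hα : α < ω_ 2) :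
    ∃ ε, η ≤ ε ∧ ε ≤ α ∧ ε.cof = ℵ_ 1 ∧
      ∃ N, ∀ n ≥ N, ε ∈ E n ∧ ∃ k, ε ∈ descent e (E n) α k := by
  have stab : ∀ β, η ≤ β → β < ω_ 2 → ∃ ε, η ≤ ε ∧ ε ≤ β ∧ ∃ N, ∀ n ≥ N,
      ε ∈ E n ∧ drop (E n) β = ε := by
    intro β hβ hβ'
    obtain ⟨N, hN⟩ := exists_forall_ge_eq (f := fun n ↦ drop (E n) β)
      fun m n h ↦ drop_mono (hanti h) β
    refine ⟨drop (E N) β, le_drop (hηE N) hβ, drop_le _ _, N, fun n hn ↦ ⟨?_, hN n hn⟩⟩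
    rw [← hN n hn]
    exact (hE n).drop_mem (hηE n) hβ hβ'
  obtain ⟨ζ, h1, h2, N₀, h3⟩ := stab α hηα hα
  obtain ⟨ε, ⟨hηε, hεα, N, hN⟩, hmin⟩ := WellFounded.has_min (wellFounded_lt (α := Ordinal.{u}))
    {ε | η ≤ ε ∧ ε ≤ α ∧ ∃ N, ∀ n ≥ N, ε ∈ E n ∧ ∃ k, ε ∈ descent e (E n) α k}
    ⟨ζ, h1, h2, N₀, fun n hn ↦ ⟨(h3 n hn).1, 0, (h3 n hn).2.symm⟩⟩
  refine ⟨ε, hηε, hεα, cof_eq_aleph_one (hεα.trans_lt hα) ?_, N, hN⟩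
  by_contra! hcof
  rcases hηε.eq_or_lt with rfl | hlt
  · exact hcof.not_gt (aleph0_lt_cof_of_eq hη)
  -- Dropping from `b < ε` with `η ≤ b` gives a smaller stable point, one step further down, against
  -- minimality.
  obtain ⟨b, hb, hηb⟩ := (he ε hcof).2 η hlt
  have hbε := (he ε hcof).1 b hb
  obtain ⟨ε', h4, h5, N', h6⟩ := stab b hηb ((hbε.trans_le hεα).trans hα)
  refine hmin ε' ⟨h4, h5.trans (hbε.le.trans hεα), max N N', fun n hn ↦
    ⟨(h6 n ((le_max_right _ _).trans hn)).1, ?_⟩⟩ (h5.trans_lt hbε)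
  obtain ⟨-, k, hk⟩ := hN n ((le_max_left _ _).trans hn)
  exact ⟨k + 1, mem_biUnion hk ⟨b, hb, (h6 n ((le_max_right _ _).trans hn)).2⟩⟩

/-- Club guessing by thin sets on a stationary set of points of cofinality `ℵ₁`. -/
theorem exists_thin_guessing {S : Set Ordinal.{u}} (hstat : IsStationaryIn S (ω_ 2))
    (hcof : ∀ δ ∈ S, δ.cof = ℵ_ 1) {Z : Ordinal.{u} → Set Ordinal.{u}}
    (hZ : ∀ δ ∈ S, IsThinIn (Z δ) δ) :
    ∃ Y : Ordinal.{u} → Set Ordinal.{u}, (∀ δ ∈ S, IsThinIn (Y δ) δ) ∧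
      ∀ E, IsClubIn E (ω_ 2) → ∃ δ ∈ S, IsUnboundedIn (Y δ ∩ E) δ := by
  have hex : ∀ ε : Ordinal.{u}, ∃ s : Set Ordinal.{u}, s.Countable ∧
      (ε.cof ≤ ℵ₀ → (∀ x ∈ s, x < ε) ∧ ∀ β < ε, ∃ x ∈ s, β ≤ x) := fun ε ↦ by
    by_cases h : ε.cof ≤ ℵ₀
    · obtain ⟨s, h1, h2⟩ := exists_countable_cofinal h
      exact ⟨s, h1, fun _ ↦ h2⟩
    · exact ⟨∅, countable_empty, fun h' ↦ absurd h' h⟩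
  choose e hec he using hex
  by_contra! hcon
  have hfail : ∀ E, IsClubIn E (ω_ 2) → ∃ E', IsClubIn E' (ω_ 2) ∧
      ∀ δ ∈ S, ¬ IsUnboundedIn (glue e (Z δ) E δ ∩ E') δ := fun E _ ↦
    hcon (fun δ ↦ glue e (Z δ) E δ) fun δ hδ ↦ isThinIn_glue hec E (hZ δ hδ)
  choose! F hF hF' using hfail
  have hclub : ∀ i : Ordinal.{u}, i.card ≤ ℵ_ 1 → IsClubIn (refineSeq F (ω_ 2) i) (ω_ 2) :=
    fun i hi ↦ isClubIn_refineSeq aleph0_lt_cof_omega_two hF i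
      (hi.trans_lt aleph_one_lt_cof_omega_two)
  have hnat : ∀ n : ℕ, IsClubIn (refineSeq F (ω_ 2) n) (ω_ 2) := fun n ↦ hclub n (by
    simpa using natCast_lt_aleph0.le.trans (aleph0_le_aleph 1))
  have hω := hclub ω (by simp)
  obtain ⟨δ, hδ, hδu⟩ := exists_mem_isUnboundedIn_cof_eq hstat hω
  have hδ2 : δ < ω_ 2 := hstat.1 hδ
  have hbd : ∀ n : ℕ, ∃ γ < δ, ∀ x ∈ glue e (Z δ) (refineSeq F (ω_ 2) n) δ ∩
      F (refineSeq F (ω_ 2) n), x < δ → x ≤ γ := fun n ↦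
    not_isUnboundedIn.1 (hF' _ (hnat n) δ hδ)
  choose γ hγδ hγ using hbd
  obtain ⟨γ', hγ'δ, hγ'⟩ := exists_lt_of_countable_index (aleph0_lt_cof_of_eq (hcof δ hδ)) hγδ
  obtain ⟨η, ⟨hηE, hη⟩, hγη, hηδ⟩ := hδu γ' hγ'δ
  obtain ⟨α₀, hα₀, hηα₀, -⟩ := (hZ δ hδ).isUnboundedIn η hηδ
  -- Minimality puts all earlier members of `Z δ` below `η`, hence below the `ε ≥ η` found by
  -- descent, as `glue` demands.
  obtain ⟨α, ⟨hα, hηα⟩, hmin⟩ := WellFounded.has_min (wellFounded_lt (α := Ordinal.{u}))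
    (Z δ ∩ Ici η) ⟨α₀, hα₀, hηα₀.le⟩
  have hαδ := (hZ δ hδ).lt α hα
  have hanti : Antitone fun n : ℕ ↦ refineSeq F (ω_ 2 : Ordinal.{u}) n := by
    refine antitone_nat_of_succ_le fun n ↦ ?_
    exact (refineSeq_subset F _ (by simp : (n : Ordinal.{u}) < (n + 1 : ℕ))).trans
      inter_subset_right
  obtain ⟨ε, hηε, hεα, hεcof, N, hN⟩ := exists_descent_cof_eq he hnat hanti hη
    (fun n ↦ (refineSeq_subset F _ (natCast_lt_omega0 n) hηE).2) hηα (hαδ.trans hδ2)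
  -- Membership at stage `N + 1` is what yields membership in `F` of stage `N`.
  have hεF := (refineSeq_subset F _ (by simp : (N : Ordinal.{u}) < (N + 1 : ℕ))
    (hN (N + 1) N.le_succ).1).1
  have hεδ := hεα.trans_lt hαδ
  refine (hγ N ε ⟨Or.inl ⟨hεδ, hεcof, α, hα, (hN N le_rfl).2, fun c hc hcα ↦ ?_⟩, hεF⟩
    hεδ).not_gt ((hγ' N).trans (hγη.trans_le hηε))
  by_contra! hεc
  exact hmin c ⟨hc, hηε.trans hεc.le⟩ hcα

/-! ### Splitting into countably many colours -/

theorem exists_ncard_inter_Iio_eq {X : Set Ordinal.{u}} (hX : X.Infinite) (k : ℕ) :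
    ∃ ξ ∈ X, (X ∩ Iio ξ).Finite ∧ (X ∩ Iio ξ).ncard = k := by
  induction k with
  | zero =>
    obtain ⟨ξ, hξ, hmin⟩ := WellFounded.has_min (wellFounded_lt (α := Ordinal.{u})) X hX.nonempty
    have : X ∩ Iio ξ = ∅ := by
      ext x
      simpa using fun hx ↦ not_lt.1 (hmin x hx)
    exact ⟨ξ, hξ, by simp [this]⟩
  | succ k ih =>
    obtain ⟨ξ, hξ, hfin, hk⟩ := ih
    have hne : (X \ insert ξ (X ∩ Iio ξ)).Nonempty := (hX.sdiff (hfin.insert ξ)).nonempty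
    obtain ⟨ξ', hξ', hmin⟩ := WellFounded.has_min (wellFounded_lt (α := Ordinal.{u})) _ hne
    have hlt : ξ < ξ' := by
      by_contra! h
      exact hξ'.2 (h.eq_or_lt.imp id fun h ↦ ⟨hξ'.1, h⟩)
    have : X ∩ Iio ξ' = insert ξ (X ∩ Iio ξ) := by
      ext x
      refine ⟨fun hx ↦ ?_, ?_⟩
      · by_contra h
        exact hmin x ⟨hx.1, h⟩ hx.2
      · rintro (rfl | hx)
        · exact ⟨hξ, hlt⟩
        · exact ⟨hx.1, lt_trans (mem_Iio.1 hx.2) hlt⟩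
    refine ⟨ξ', hξ'.1, this ▸ hfin.insert ξ, ?_⟩
    rw [this, ncard_insert_of_notMem (by simp) hfin, hk]

/-- A decreasing `ω₁`-sequence of sets is eventually constant on a countable set. -/
theorem exists_inter_subset_of_antitone {G : Ordinal.{u} → Set Ordinal.{u}}
    (hG : ∀ i j, i ≤ j → G j ⊆ G i) {K : Set Ordinal.{u}} (hK : K.Countable) :
    ∃ i < ω_ 1, ∀ j < ω_ 1, G i ∩ K ⊆ G j := by
  -- Each point has a stage past which its membership no longer changes; countably many such stages
  -- are bounded below `ω₁`.
  have hex : ∀ ξ : Ordinal.{u}, ∃ i < ω_ 1, ξ ∈ G i → ∀ j < ω_ 1, ξ ∈ G j := by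
    intro ξ
    by_cases h : ∀ j < ω_ 1, ξ ∈ G j
    · exact ⟨0, omega_pos 1, fun _ ↦ h⟩
    · push Not at h
      obtain ⟨j, hj, hξ⟩ := h
      exact ⟨j, hj, fun h ↦ absurd h hξ⟩
  choose i hi hi' using hex
  obtain ⟨γ, hγ, hγ'⟩ := exists_lt_of_countable (δ := ω_ 1)
    (aleph0_lt_cof_of_eq isRegular_aleph_one.cof_omega_eq) (hK.image i)
    (by rintro _ ⟨ξ, -, rfl⟩; exact hi ξ)
  exact ⟨γ, hγ, fun j hj ξ hξ ↦
    hi' ξ (hG _ _ (hγ' _ (mem_image_of_mem i hξ.2)).le hξ.1) j hj⟩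

/-- The `ξ ∈ Y` which have the code `n`, in the coding `f` of the countable sets `Y ∩ y`, for
cofinally many `y ∈ Y ∩ E`. -/
def largeFiber (f : Set Ordinal.{u} → Ordinal.{u} → ℕ) (Y : Set Ordinal.{u}) (δ : Ordinal.{u})
    (n : ℕ) (E : Set Ordinal.{u}) : Set Ordinal.{u} :=
  {ξ | ξ ∈ Y ∧ IsUnboundedIn {y | y ∈ Y ∧ y ∈ E ∧ ξ < y ∧ f (Y ∩ Iio y) ξ = n} δ}

theorem largeFiber_mono (f : Set Ordinal.{u} → Ordinal.{u} → ℕ) (Y : Set Ordinal.{u})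
    (δ : Ordinal.{u}) (n : ℕ) {E E' : Set Ordinal.{u}} (h : E ⊆ E') :
    largeFiber f Y δ n E ⊆ largeFiber f Y δ n E' := fun _ hξ ↦
  ⟨hξ.1, hξ.2.mono fun _ hy ↦ ⟨hy.1.1, h hy.1.2.1, hy.1.2.2⟩⟩

/-- Each `ξ ∈ Y` takes some code for cofinally many `y`, else countably many bounds would bound `Y ∩
E`. As `Y` is uncountable, some code has infinitely many such `ξ`, and countably many of these are
bounded in `δ`. -/
theorem exists_infinite_largeFiber (f : Set Ordinal.{u} → Ordinal.{u} → ℕ)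
    {Y E : Set Ordinal.{u}} {δ : Ordinal.{u}} (hδ : ℵ₀ < δ.cof) (hY : IsThinIn Y δ)
    (hYE : IsUnboundedIn (Y ∩ E) δ) :
    ∃ n, ∃ σ < δ, (largeFiber f Y δ n E ∩ Iio σ).Infinite := by
  have hcov : Y ⊆ ⋃ n, largeFiber f Y δ n E := by
    intro ξ hξ
    by_contra h
    have hbd : ∀ n, ∃ γ < δ, ∀ y ∈ {y | y ∈ Y ∧ y ∈ E ∧ ξ < y ∧ f (Y ∩ Iio y) ξ = n},
        y < δ → y ≤ γ := fun n ↦ by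
      refine not_isUnboundedIn.1 fun h' ↦ h (mem_iUnion.2 ⟨n, hξ, h'⟩)
    choose γ hγ hγ' using hbd
    obtain ⟨γ', h1, h2⟩ := exists_lt_of_countable_index hδ hγ
    obtain ⟨y, h3, h4, h5⟩ := hYE _ (max_lt h1 (hY.lt ξ hξ))
    exact (hγ' _ y ⟨h3.1, h3.2, (le_max_right _ _).trans_lt h4, rfl⟩ h5).not_gt
      ((h2 _).trans ((le_max_left _ _).trans_lt h4))
  have hinf : ∃ n, (largeFiber f Y δ n E).Infinite := by
    by_contra! h
    refine hY.isUnboundedIn.not_countable hδ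
      (((countable_iUnion fun n ↦ (h n).countable).mono hcov).mono inter_subset_left)
  obtain ⟨n, hn⟩ := hinf
  obtain ⟨σ, hσ, hσ'⟩ := exists_lt_of_countable_index hδ
    (f := fun k : ℕ ↦ (hn.natEmbedding _ k : Ordinal.{u})) fun k ↦ hY.lt _ (hn.natEmbedding _ k).2.1
  refine ⟨n, σ, hσ, infinite_of_injective_forall_mem
    (f := fun k : ℕ ↦ (hn.natEmbedding _ k : Ordinal.{u})) ?_ fun k ↦
      ⟨(hn.natEmbedding _ k).2, hσ' k⟩⟩
  exact Subtype.val_injective.comp (hn.natEmbedding _).injective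

/-- The colouring of `Y` which colours `y` by the position in `largeFiber f Y δ n E` of the
point whose code below `y` is `n`. -/
noncomputable def fiberRank (f : Set Ordinal.{u} → Ordinal.{u} → ℕ) (Y : Set Ordinal.{u})
    (δ : Ordinal.{u}) (n : ℕ) (E : Set Ordinal.{u}) (y : Ordinal.{u}) : ℕ :=
  (largeFiber f Y δ n E ∩ Iio (sInf {ξ | ξ ∈ Y ∩ Iio y ∧ f (Y ∩ Iio y) ξ = n})).ncard

theorem fiberRank_eq {f : Set Ordinal.{u} → Ordinal.{u} → ℕ} {Y : Set Ordinal.{u}}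
    (δ : Ordinal.{u}) {n : ℕ} (E : Set Ordinal.{u}) {y ξ : Ordinal.{u}}
    (hf : InjOn (f (Y ∩ Iio y)) (Y ∩ Iio y)) (hξ : ξ ∈ Y ∩ Iio y) (hn : f (Y ∩ Iio y) ξ = n) :
    fiberRank f Y δ n E y = (largeFiber f Y δ n E ∩ Iio ξ).ncard := by
  have : {ξ | ξ ∈ Y ∩ Iio y ∧ f (Y ∩ Iio y) ξ = n} = {ξ} := by
    ext x
    refine ⟨fun hx ↦ hf hx.1 hξ (hx.2.trans hn.symm), ?_⟩
    rintro rfl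
    exact ⟨hξ, hn⟩
  rw [fiberRank, this, csInf_singleton]

/-- A guessing system of thin sets can be split into countably many simultaneously guessing
parts. -/
theorem exists_coloring {S : Set Ordinal.{u}} (hcof : ∀ δ ∈ S, δ.cof = ℵ_ 1)
    {Y : Ordinal.{u} → Set Ordinal.{u}} (hY : ∀ δ ∈ S, IsThinIn (Y δ) δ)
    (hguess : ∀ E, IsClubIn E (ω_ 2) → ∃ δ ∈ S, IsUnboundedIn (Y δ ∩ E) δ) :
    ∃ h : Ordinal.{u} → Ordinal.{u} → ℕ, ∀ E, IsClubIn E (ω_ 2) →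
      ∃ δ ∈ S, ∀ n, IsUnboundedIn ({y | y ∈ Y δ ∧ h δ y = n} ∩ E) δ := by
  have hex : ∀ A : Set Ordinal.{u}, ∃ g : Ordinal.{u} → ℕ, A.Countable → InjOn g A := fun A ↦ by
    by_cases h : A.Countable
    · obtain ⟨g, hg⟩ := countable_iff_exists_injOn.1 h
      exact ⟨g, fun _ ↦ hg⟩
    · exact ⟨fun _ ↦ 0, fun h' ↦ absurd h' h⟩
  choose f hf using hex
  by_contra! hcon
  have hfail : ∀ (E : Set Ordinal.{u}) (n : ℕ), ∃ E', IsClubIn E' (ω_ 2) ∧ ∀ δ ∈ S, ∃ k,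
      ¬ IsUnboundedIn ({y | y ∈ Y δ ∧ fiberRank f (Y δ) δ n E y = k} ∩ E') δ := fun E n ↦
    hcon fun δ ↦ fiberRank f (Y δ) δ n E
  choose F hF hF' using hfail
  let F₀ : Set Ordinal.{u} → Set Ordinal.{u} := fun E ↦
    Iio (ω_ 2) ∩ ⋂ n : ULift.{u} ℕ, F E n.down
  have hF₀ : ∀ E, IsClubIn (F₀ E) (ω_ 2) := fun E ↦ by
    refine IsClubIn.iInter aleph0_lt_cof_omega_two ?_ fun n ↦ hF E n.down
    simpa using aleph0_lt_cof_omega_two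
  have hlast : IsClubIn (refineSeq F₀ (ω_ 2) (ω_ 1)) (ω_ 2) :=
    isClubIn_refineSeq aleph0_lt_cof_omega_two (fun E _ ↦ hF₀ E) _
      (by simpa using aleph_one_lt_cof_omega_two)
  obtain ⟨δ, hδ, hu⟩ := hguess _ hlast
  obtain ⟨n, σ, hσ, hinf⟩ := exists_infinite_largeFiber f (aleph0_lt_cof_of_eq (hcof δ hδ))
    (hY δ hδ) hu
  have hanti : ∀ i j, i ≤ j → refineSeq F₀ (ω_ 2) j ⊆ refineSeq F₀ (ω_ 2) i := fun i j hij ↦ by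
    obtain rfl | hlt := hij.eq_or_lt
    · exact subset_rfl
    · exact (refineSeq_subset _ _ hlt).trans inter_subset_right
  obtain ⟨i, hi, hstab⟩ := exists_inter_subset_of_antitone
    (G := fun i ↦ largeFiber f (Y δ) δ n (refineSeq F₀ (ω_ 2) i))
    (fun i j hij ↦ largeFiber_mono _ _ _ _ (hanti i j hij)) ((hY δ hδ).countable σ hσ)
  have hi' : i + 1 < ω_ 1 := (isSuccLimit_omega 1).add_one_lt hi
  obtain ⟨k, hk⟩ := hF' (refineSeq F₀ (ω_ 2) i) n δ hδ
  obtain ⟨ξ, ⟨hξ, hξσ⟩, -, hcard⟩ := exists_ncard_inter_Iio_eq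
    (hinf.mono (inter_subset_inter_left _ (largeFiber_mono f (Y δ) δ n (hanti i _ hi.le)))) k
  -- Since `ξ < σ`, its rank in the part below `σ` is its rank in the whole fiber.
  rw [inter_assoc, Iio_inter_Iio, inf_eq_right.2 (mem_Iio.1 hξσ).le] at hcard
  -- By stability `ξ` is still in the fiber for stage `i + 1`, whose points lie in the club that was
  -- to omit colour `k`.
  refine hk ((hstab _ hi' ⟨hξ, hξ.1, hξσ⟩).2.mono ?_)
  rintro y ⟨⟨hy, hyE, hξy, hn⟩, hyδ⟩
  refine ⟨⟨hy, ?_⟩, ?_⟩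
  · rw [fiberRank_eq δ _ (hf _ ((hY δ hδ).countable y hyδ)) ⟨hξ.1, hξy⟩ hn, hcard]
  · exact mem_iInter.1 (refineSeq_subset F₀ _ (lt_add_one i) hyE).1.2 ⟨n⟩

end ClubGuessing

/-! ### Assembly -/

theorem claim3p1 (S : Set Ordinal.{u})
    (hS : S ⊆ {δ | δ < ω_ 2 ∧ δ.cof = ℵ_ 1 ∧ ω_ 1 ^ (2 : ℕ) ∣ δ})
    (hstat : ClubGuessing.IsStationaryIn S (ω_ 2)) :
    ∃ C : Ordinal.{u} → Set Ordinal.{u},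
      ClubGuessing.IsStrictClubSystem S C ∧
      Iio (ω_ 2) ∉ ClubGuessing.idP (ω_ 2) S C ∧
      (∀ δ ∈ S, ∀ α ∈ ClubGuessing.nacc (C δ), α.cof = ℵ_ 1) ∧
      ∃ h : (δ : Ordinal.{u}) → C δ → ℕ,
        ∀ E, ClubGuessing.IsClubIn E (ω_ 2) →
          ∃ δ ∈ S, ∀ n : ℕ,
            ClubGuessing.IsUnboundedIn
              ((Subtype.val '' (h δ ⁻¹' {n})) ∩ E ∩ ClubGuessing.nacc (C δ)) δ := by
  have hcof : ∀ δ ∈ S, δ.cof = ℵ_ 1 := fun δ hδ ↦ (hS hδ).2.1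
  have h0 : ∀ δ ∈ S, δ ≠ 0 := by
    rintro δ hδ rfl
    simpa using ClubGuessing.aleph0_lt_cof_of_eq (hcof 0 hδ)
  have hex : ∀ δ ∈ S, ∃ Z, ClubGuessing.IsThinIn Z δ := fun δ hδ ↦
    ClubGuessing.exists_isThinIn (hcof δ hδ)
      (ClubGuessing.isUnboundedIn_cof_eq_of_dvd (h0 δ hδ) (hS hδ).2.2)
  choose! Z hZ using hex
  obtain ⟨Y, hY, hguess⟩ := ClubGuessing.exists_thin_guessing hstat hcof hZ
  obtain ⟨h, hh⟩ := ClubGuessing.exists_coloring hcof hY hguess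
  refine ⟨fun δ ↦ (Y δ ∪ ClubGuessing.acc (Y δ)) ∩ Iio δ,
    fun δ hδ ↦ ⟨(hY δ hδ).isClubIn, (hY δ hδ).type_eq (hcof δ hδ)⟩, ?_, fun δ hδ α hα ↦ ?_,
    fun δ x ↦ h δ x, fun E hE ↦ ?_⟩
  · rintro ⟨-, E, hE, hE'⟩
    obtain ⟨δ, hδ, hu⟩ := hguess E hE
    -- That `Y δ ∩ E` is unbounded also gives `δ ∈ acc E`.
    refine (hE' δ ⟨hδ, h0 δ hδ, hu.mono fun x hx ↦ hx.1.2⟩).2 (hu.mono ?_)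
    rintro x ⟨⟨hxY, hxE⟩, hxδ⟩
    refine ⟨⟨⟨hE.1 hxE, hxE⟩, Or.inl hxY, hxδ⟩, ?_⟩
    rwa [(hY δ hδ).nacc_eq]
  · rw [(hY δ hδ).nacc_eq] at hα
    exact (hY δ hδ).cof_eq α hα
  · obtain ⟨δ, hδ, hu⟩ := hh E hE
    refine ⟨δ, hδ, fun n ↦ (hu n).mono ?_⟩
    rintro x ⟨⟨⟨hxY, hxn⟩, hxE⟩, hxδ⟩
    rw [(hY δ hδ).nacc_eq]
    exact ⟨⟨⟨⟨x, Or.inl hxY, hxδ⟩, hxn, rfl⟩, hxE⟩, hxY⟩
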